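/- Let $G\subset GL_n(\mathbb C)$ be a connected real semisimple matrix Lie group with Lie algebra $\mathfrak g$, let $h\in G$ be such that $\sigma(g)=hgh^{-1}$ is an involution of $G$ ($\sigma^2=\mathrm{id}$), and let $\hat K=\{g\in G:\sigma(g)=g\}$, $\mathfrak g=\mathfrak k\oplus\mathfrak p$ the eigenspace decomposition of $\sigma$. Fix a regularity class $C^r$ ($0\le r\le\infty$ or $r=\omega$) and let $\Lambda G$ be the group of $C^r$ loops $\gamma:S^1\to G$, $\Omega G=\{\gamma\in\Lambda G:\gamma(1)=e\}$, $\Lambda G_\sigma=\{\gamma\in\Lambda G:\sigma(\gamma(\lambda))=\gamma(-\lambda)\}$. Let $M$ be a connected Riemann surface with universal cover $\pi:\tilde M\to M$, $z_0\in\tilde M$, and let $\mathcal F:M\to G/\hat K$ be a harmonic map. An *extended frame* of $\mathcal F$ is a map $F:\tilde M\setminus S\to\Lambda G_\sigma$, smooth in $z$, where $S=\emptyset$ if $\tilde M$ is non-compact and $S$ is a set of at most two points, $z_0\notin S$, if $\tilde M$ is a sphere, such that $F(z,1)\hat K=\mathcal F(\pi(z))$, $F(z_0,\lambda)=e$ for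 all $\lambda\in S^1$, and $$dF(\cdot,\lambda)=F(\cdot,\lambda)\,(\lambda^{-1}\alpha_{\mathfrak p}'+\alpha_{\mathfrak k}+\lambda\alpha_{\mathfrak p}''),\qquad \alpha=F(\cdot,1)^{-1}dF(\cdot,1)=\alpha_{\mathfrak k}+\alpha_{\mathfrak p},$$ where $\alpha_{\mathfrak p}'$ and $\alpha_{\mathfrak p}''$ are the $(1,0)$- and $(0,1)$-parts of $\alpha_{\mathfrak p}$. The map $\mathcal F$ is *algebraic* if some extended frame of $\mathcal F$ is a Laurent polynomial in $\lambda$, i.e. of the form $\sum_{|k|\le N}\lambda^k c_k(z)$ with matrix-valued functions $c_k$ on $\tilde M\setminus S$. Let $\mathbb F:\tilde M\to G$ be the composition of $\mathcal F\circ\pi$ with the modified Cartan embedding $g\hat K\mapsto ghg^{-1}$. An *extended solution* of $\mathbb F$ is a map $\Phi:\tilde M\to\Omega G$, smooth in $z$, with $\Phi(z,-1)=\mathbb F(z)$ and, for $\mathbb A=\frac12\mathbb F^{-1}d\mathbb F$, $$\partial\Phi=(1-\lambda^{-1})\,\Phi\,\mathbb A^{(1,0)},\qquad \bar\partial\Phi=(1-\lambda)\,\Phi\,\mathbb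 A^{(0,1)}\qquad(\lambda\in S^1).$$ Suppose that $F$ is an extended frame of $\mathcal F$ and $\Phi$ is an extended solution of $\mathbb F$. Then $\mathcal F$ is algebraic if and only if there exists $B\in\Omega G$ such that $B\Phi$ is a Laurent polynomial in $\lambda$, i.e. $B(\lambda)\Phi(z,\lambda)=\sum_{|k|\le N}\lambda^k c_k(z)$ on $\tilde M$ for some $N$ and matrix-valued functions $c_k$. -/

import Mathlib

open scoped ContDiff Manifold

attribute [local instance] LieRing.ofAssociativeRing

namespace AlgHarm

noncomputable section

/-! ### Groups and symmetric spaces -/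

/-- The connected matrix Lie group with Lie algebra `𝔤 ⊆ M_n(ℂ)` (a real Lie subalgebra), that is
the subgroup of `GL_n(ℂ)` generated by `exp 𝔤`. -/
def matrixGroup {n : ℕ} (𝔤 : LieSubalgebra ℝ (Matrix (Fin n) (Fin n) ℂ)) :
    Subgroup (GL (Fin n) ℂ) :=
  Subgroup.closure {g | ∃ X ∈ 𝔤, (g : Matrix (Fin n) (Fin n) ℂ) = NormedSpace.exp X}

/-- The underlying matrix of an element of a matrix group. -/
def mat {n : ℕ} {G : Subgroup (GL (Fin n) ℂ)} (g : G) : Matrix (Fin n) (Fin n) ℂ :=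
  ((g : GL (Fin n) ℂ) : Matrix (Fin n) (Fin n) ℂ)

/-- The inner automorphism `σ(g) = h g h⁻¹`. -/
def symm {Γ : Type*} [Group Γ] (h : Γ) : Γ →* Γ := (MulAut.conj h).toMonoidHom

/-- The fixed point group `K̂ = Fix σ` of `σ(g) = h g h⁻¹`. -/
def fixSub {Γ : Type*} [Group Γ] (h : Γ) : Subgroup Γ :=
  (symm h).eqLocus (MonoidHom.id Γ)

/-- The modified Cartan embedding `G/K̂ → G`, `g K̂ ↦ g h g⁻¹`. -/
def cartan {Γ : Type*} [Group Γ] (h : Γ) : Γ ⧸ fixSub h → Γ :=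
  Quotient.lift (fun g : Γ => g * h * g⁻¹) (by
    intro a b hab
    have h1 : a⁻¹ * b ∈ fixSub h := QuotientGroup.leftRel_apply.mp hab
    have h2 : h * (a⁻¹ * b) * h⁻¹ = a⁻¹ * b := h1
    have h3 : h * (a⁻¹ * b) = a⁻¹ * b * h := mul_inv_eq_iff_eq_mul.mp h2
    have h4 : b = a * (a⁻¹ * b) := by group
    have h5 : b * h * b⁻¹ = a * (a⁻¹ * b * h) * b⁻¹ := by group
    change a * h * a⁻¹ = b * h * b⁻¹
    rw [h5, ← h3]
    group)

/-- The `𝔨`-part `(X + h X h⁻¹)/2` of a matrix. -/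
def kPart {n : ℕ} {G : Subgroup (GL (Fin n) ℂ)} (h : G) (X : Matrix (Fin n) (Fin n) ℂ) :
    Matrix (Fin n) (Fin n) ℂ :=
  (2⁻¹ : ℂ) • (X + mat h * X * mat h⁻¹)

/-- The `𝔭`-part `(X - h X h⁻¹)/2` of a matrix. -/
def pPart {n : ℕ} {G : Subgroup (GL (Fin n) ℂ)} (h : G) (X : Matrix (Fin n) (Fin n) ℂ) :
    Matrix (Fin n) (Fin n) ℂ :=
  (2⁻¹ : ℂ) • (X - mat h * X * mat h⁻¹)

/-! ### Differentials on a Riemann surface -/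

/-- Smoothness (in the real sense) on a set, of a matrix-valued function on a Riemann surface. -/
def SmoothOn {n : ℕ} {X : Type*} [TopologicalSpace X] [ChartedSpace ℂ X]
    (f : X → Matrix (Fin n) (Fin n) ℂ) (D : Set X) : Prop :=
  ∀ i j, ContMDiffOn 𝓘(ℝ, ℂ) 𝓘(ℝ, ℂ) ∞ (fun x => f x i j) D

/-- The real differential of a matrix-valued function on a Riemann surface. The tangent space at `x`
is `ℂ` through the preferred chart at `x`, with complex structure multiplication by `i`. -/
def rdiff {n : ℕ} {X : Type*} [TopologicalSpace X] [ChartedSpace ℂ X]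
    (f : X → Matrix (Fin n) (Fin n) ℂ) (x : X) (v : ℂ) : Matrix (Fin n) (Fin n) ℂ :=
  Matrix.of fun i j => mfderiv 𝓘(ℝ, ℂ) 𝓘(ℝ, ℂ) (fun y => f y i j) x v

/-- The `(1,0)`-part of a real-linear map on a complex line. -/
def part10 {n : ℕ} (L : ℂ → Matrix (Fin n) (Fin n) ℂ) (v : ℂ) : Matrix (Fin n) (Fin n) ℂ :=
  (2⁻¹ : ℂ) • (L v - Complex.I • L (Complex.I * v))

/-- The `(0,1)`-part of a real-linear map on a complex line. -/
def part01 {n : ℕ} (L : ℂ → Matrix (Fin n) (Fin n) ℂ) (v : ℂ) : Matrix (Fin n) (Fin n) ℂ :=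
  (2⁻¹ : ℂ) • (L v + Complex.I • L (Complex.I * v))

/-- The (left) Maurer-Cartan form `f⁻¹ df` of a `G`-valued function. -/
def maurerCartan {n : ℕ} {G : Subgroup (GL (Fin n) ℂ)} {X : Type*} [TopologicalSpace X]
    [ChartedSpace ℂ X] (f : X → G) (x : X) (v : ℂ) : Matrix (Fin n) (Fin n) ℂ :=
  mat (f x)⁻¹ * rdiff (fun y => mat (f y)) x v

/-! ### Harmonic maps into `G/K̂` -/

/-- The tension field, in the conformal coordinate `w = x + i y` and translated back to `𝔭` by the
frame `f`, of the map `f K̂` into the symmetric space `G/K̂` with its canonical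
(Levi-Civita) connection: `∑_v (∂_v (α_𝔭(v)) + [α_𝔨(v), α_𝔭(v)])`, `v = ∂_x, ∂_y`,
`α = f⁻¹ df`. -/
def tension {n : ℕ} {G : Subgroup (GL (Fin n) ℂ)} (h : G) (f : ℂ → G) (w : ℂ) :
    Matrix (Fin n) (Fin n) ℂ :=
  ∑ j : Fin 2,
    (rdiff (fun u => pPart h (maurerCartan f u (![1, Complex.I] j))) w (![1, Complex.I] j)
      + (kPart h (maurerCartan f w (![1, Complex.I] j))
          * pPart h (maurerCartan f w (![1, Complex.I] j))
        - pPart h (maurerCartan f w (![1, Complex.I] j))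
          * kPart h (maurerCartan f w (![1, Complex.I] j))))

/-- Smooth harmonic maps from a Riemann surface into `G/K̂`: near every point there is a smooth lift
to `G` in the holomorphic chart at that point, and the tension field vanishes. -/
def IsHarmonic {n : ℕ} {G : Subgroup (GL (Fin n) ℂ)} (h : G) {M : Type*} [TopologicalSpace M]
    [ChartedSpace ℂ M] (𝓕 : M → G ⧸ fixSub h) : Prop :=
  ∀ p : M, ∃ U : Set ℂ, IsOpen U ∧ chartAt ℂ p p ∈ U ∧ U ⊆ (chartAt ℂ p).target ∧
    ∃ f : ℂ → G, SmoothOn (fun w => mat (f w)) U ∧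
      ∀ w ∈ U, (f w : G ⧸ fixSub h) = 𝓕 ((chartAt ℂ p).symm w) ∧ tension h f w = 0

/-! ### Loop groups -/

/-- The loop group `ΛG` of loops `S¹ → G` of class `C^r`. -/
def loops {n : ℕ} (r : WithTop ℕ∞) (G : Subgroup (GL (Fin n) ℂ)) : Set (Circle → G) :=
  {γ | ∀ i j, ContDiff ℝ r (fun t : ℝ => mat (γ (Circle.exp t)) i j)}

/-- The based loop group `ΩG`. -/
def basedLoops {n : ℕ} (r : WithTop ℕ∞) (G : Subgroup (GL (Fin n) ℂ)) : Set (Circle → G) :=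
  {γ | γ ∈ loops r G ∧ γ 1 = 1}

/-- The twisted loop group `ΛG_σ`, `σ(g) = h g h⁻¹`. -/
def twistedLoops {n : ℕ} (r : WithTop ℕ∞) {G : Subgroup (GL (Fin n) ℂ)} (h : G) :
    Set (Circle → G) :=
  {γ | γ ∈ loops r G ∧ ∀ l : Circle, symm h (γ l) = γ (-l)}

/-- `f(z, λ)`, `z ∈ D`, is a Laurent polynomial in `λ ∈ S¹`. -/
def IsLaurentOn {n : ℕ} {G : Subgroup (GL (Fin n) ℂ)} {X : Type*} (D : Set X)
    (f : X → Circle → G) : Prop :=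
  ∃ (N : ℕ) (c : ℤ → X → Matrix (Fin n) (Fin n) ℂ), ∀ z ∈ D, ∀ l : Circle,
    mat (f z l) = ∑ k ∈ Finset.Icc (-(N : ℤ)) N, ((l : ℂ) ^ k) • c k z

/-! ### Extended frames and extended solutions -/

/-- The form `α_λ = λ⁻¹ α_𝔭' + α_𝔨 + λ α_𝔭''`. -/
def alphaLoop {n : ℕ} {G : Subgroup (GL (Fin n) ℂ)} (h : G)
    (α : ℂ → Matrix (Fin n) (Fin n) ℂ) (l : Circle) (v : ℂ) : Matrix (Fin n) (Fin n) ℂ :=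
  (l : ℂ)⁻¹ • part10 (fun u => pPart h (α u)) v + kPart h (α v)
    + (l : ℂ) • part01 (fun u => pPart h (α u)) v

/-- `F` is an extended frame, based at `z₀` and with singular set `S`, of the map `𝓕` from a
simply connected Riemann surface into `G/K̂`. The set `S` has at most two points and is empty unless
the surface is compact (a sphere). -/
structure IsExtendedFrame {n : ℕ} (r : WithTop ℕ∞) {G : Subgroup (GL (Fin n) ℂ)} (h : G)
    {X : Type*} [TopologicalSpace X] [ChartedSpace ℂ X] (𝓕 : X → G ⧸ fixSub h) (z₀ : X)
    (S : Set X) (F : X → Circle → G) : Prop where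
  encard_le : S.encard ≤ 2
  compact_of_nonempty : S.Nonempty → CompactSpace X
  base_notMem : z₀ ∉ S
  smooth : ∀ l : Circle, SmoothOn (fun z => mat (F z l)) Sᶜ
  twisted : ∀ z ∉ S, F z ∈ twistedLoops r h
  frame : ∀ z ∉ S, (F z 1 : G ⧸ fixSub h) = 𝓕 z
  base : ∀ l : Circle, F z₀ l = 1
  ode : ∀ z ∉ S, ∀ (l : Circle) (v : ℂ),
    rdiff (fun y => mat (F y l)) z v =
      mat (F z l) * alphaLoop h (maurerCartan (fun y => F y 1) z) l v

/-- A map `𝓕` from a simply connected Riemann surface into `G/K̂` is algebraic: some extended frame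
is a Laurent polynomial in `λ`. -/
def IsAlgebraic {n : ℕ} (r : WithTop ℕ∞) {G : Subgroup (GL (Fin n) ℂ)} (h : G)
    {X : Type*} [TopologicalSpace X] [ChartedSpace ℂ X] (𝓕 : X → G ⧸ fixSub h) (z₀ : X) : Prop :=
  ∃ (S : Set X) (F : X → Circle → G), IsExtendedFrame r h 𝓕 z₀ S F ∧ IsLaurentOn Sᶜ F

/-- `Φ` is an extended solution of the map `φ` into `G`: with `A = φ⁻¹ dφ / 2`,
`∂Φ = (1 - λ⁻¹) Φ A^{(1,0)}`, `∂̄Φ = (1 - λ) Φ A^{(0,1)}`, `Φ(λ = 1) = e`, `Φ(λ = -1) = φ`. -/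
structure IsExtendedSolution {n : ℕ} (r : WithTop ℕ∞) {G : Subgroup (GL (Fin n) ℂ)}
    {X : Type*} [TopologicalSpace X] [ChartedSpace ℂ X] (φ : X → G) (Φ : X → Circle → G) :
    Prop where
  smooth : ∀ l : Circle, SmoothOn (fun z => mat (Φ z l)) Set.univ
  based : ∀ z, Φ z ∈ basedLoops r G
  neg_one : ∀ z, Φ z (-1) = φ z
  eq10 : ∀ (z : X) (l : Circle) (v : ℂ),
    part10 (rdiff (fun y => mat (Φ y l)) z) v =
      (1 - (l : ℂ)⁻¹) • (mat (Φ z l) * part10 (fun u => (2⁻¹ : ℂ) • maurerCartan φ z u) v)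
  eq01 : ∀ (z : X) (l : Circle) (v : ℂ),
    part01 (rdiff (fun y => mat (Φ y l)) z) v =
      (1 - (l : ℂ)) • (mat (Φ z l) * part01 (fun u => (2⁻¹ : ℂ) • maurerCartan φ z u) v)

end

end AlgHarm

namespace AlgHarm

/-! ### Determinants in a semisimple matrix group -/

section Det

open scoped Matrix.Norms.Operator

/-! Everything rests on the identity `Φ(z,λ) F(z,1) = Φ(z₀,λ) F(z,λ)` off `S`
(`solution_mul_frame_eq`). The differential of the Cartan embedding gives `𝔸 = -Ad(F(z,1)) α_𝔭`, so
gauging `Φ` by `F(·,1)` turns its equation into that of the extended frame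
(`rdiff_solution_mul_frame`). The quotient of two solutions of this equation is locally constant,
and a finite set does not disconnect a connected surface (`eq_of_locallyConstant_off_finite`).

If some frame is Laurent, take `B = Φ(z₀,·)⁻¹`: then `BΦ = F(z,λ) F(z,1)⁻¹` is Laurent off `S`, and
everywhere by continuity (`mem_laurentSubring_univ_of_dense`). Conversely, `F = (BΦ(z₀))⁻¹ (BΦ(z))
F(z,1)`. Here the inverse of a Laurent polynomial loop must again be one; this holds because
semisimplicity forces determinant 1 (`det_mat_eq_one`), so that inverses are adjugates. -/

lemma differentiable_det {n : ℕ} :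
    Differentiable ℝ (fun A : Matrix (Fin n) (Fin n) ℂ => A.det) := by
  have hentry : ∀ i j, Differentiable ℝ (fun A : Matrix (Fin n) (Fin n) ℂ => A i j) := fun i j =>
    (LinearMap.toContinuousLinearMap (Matrix.entryLinearMap ℝ ℂ i j)).differentiable
  simp only [Matrix.det_apply]
  fun_prop

lemma hasDerivAt_det_one_add_smul {n : ℕ} (X : Matrix (Fin n) (Fin n) ℂ) :
    HasDerivAt (fun t : ℝ => (1 + t • X).det) X.trace 0 := by
  have h1 := ((1 + (Polynomial.X : Polynomial ℂ) • X.map Polynomial.C).det).hasDerivAt (0 : ℂ)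
  rw [Matrix.derivative_det_one_add_X_smul] at h1
  have h2 : HasDerivAt (fun z : ℂ => (1 + z • X).det) X.trace ((0 : ℝ) : ℂ) := by
    rw [Complex.ofReal_zero]
    refine h1.congr_of_eventuallyEq (Filter.Eventually.of_forall fun z => ?_)
    change _ = Polynomial.eval z _
    rw [← Polynomial.coe_evalRingHom, RingHom.map_det]
    refine congrArg Matrix.det (Matrix.ext fun i j => ?_)
    by_cases hij : i = j <;> simp [hij, mul_comm z]
  exact h2.comp_ofReal

/-- The function `t ↦ det exp(tX)` is multiplicative and has derivative `tr X = 0` at 0, hence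
derivative 0 everywhere. -/
lemma det_exp_of_trace_eq_zero {n : ℕ} {X : Matrix (Fin n) (Fin n) ℂ} (hX : X.trace = 0) :
    (NormedSpace.exp X).det = 1 := by
  have hE : HasDerivAt (fun t : ℝ => NormedSpace.exp (t • X)) X 0 := by
    have h0 := hasDerivAt_exp_smul_const (𝕂 := ℝ) X (0 : ℝ)
    rw [zero_smul, NormedSpace.exp_zero, one_mul] at h0
    exact h0
  have hd : HasFDerivAt (fun A : Matrix (Fin n) (Fin n) ℂ => A.det)
      (fderiv ℝ (fun A : Matrix (Fin n) (Fin n) ℂ => A.det) 1) 1 :=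
    (differentiable_det 1).hasFDerivAt
  have hl : HasDerivAt (fun t : ℝ => 1 + t • X) X 0 := by
    have h0 := ((hasDerivAt_id (0 : ℝ)).smul_const X).const_add 1
    rw [one_smul] at h0
    exact h0
  -- The lines `1 + tX` and `exp(tX)` have the same velocity at 0, so the derivative of `det` at 1,
  -- computed on the first, serves for the second.
  have h1 := HasFDerivAt.comp_hasDerivAt_of_eq (0 : ℝ) hd hl (by simp)
  have h2 := h1.unique (hasDerivAt_det_one_add_smul X)
  have h3 : HasDerivAt (fun t : ℝ => (NormedSpace.exp (t • X)).det) 0 0 := by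
    have := HasFDerivAt.comp_hasDerivAt_of_eq (0 : ℝ) hd hE (by simp)
    rwa [h2, hX] at this
  have h4 : ∀ t : ℝ, HasDerivAt (fun t : ℝ => (NormedSpace.exp (t • X)).det) 0 t := by
    intro t
    have h5 : (fun s : ℝ => (NormedSpace.exp (s • X)).det) =
        fun s => (NormedSpace.exp (t • X)).det * (NormedSpace.exp ((s - t) • X)).det := by
      funext s
      rw [← Matrix.det_mul, ← Matrix.exp_add_of_commute _ _
        (((Commute.refl X).smul_left t).smul_right (s - t)), ← add_smul]
      simp
    rw [h5]
    have h6 : HasDerivAt (fun s : ℝ => (NormedSpace.exp ((s - t) • X)).det) 0 t := by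
      have h3' : HasDerivAt (fun t : ℝ => (NormedSpace.exp (t • X)).det) 0 (t - t) := by
        simpa using h3
      exact h3'.comp_sub_const t t
    simpa using h6.const_mul (NormedSpace.exp (t • X)).det
  have h7 := is_const_of_deriv_eq_zero (fun t => (h4 t).differentiableAt) (fun t => (h4 t).deriv) 1 0
  simpa using h7

end Det

/-- The algebra is the supremum of its minimal ideals `I`; each is non-abelian, so `⁅I, I⁆ = I` by
minimality. -/
lemma lie_top_eq_top_of_isSemisimple {L : Type*} [LieRing L] [LieAlgebra ℝ L]
    (hL : LieAlgebra.IsSemisimple ℝ L) :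
    ⁅(⊤ : LieIdeal ℝ L), (⊤ : LieIdeal ℝ L)⁆ = ⊤ := by
  rw [eq_top_iff, ← hL.sSup_atoms_eq_top]
  refine sSup_le fun I hI => ?_
  have h1 : ⁅I, I⁆ ≠ ⊥ := fun h0 =>
    hL.non_abelian_of_isAtom I hI (LieSubmodule.lie_abelian_iff_lie_self_eq_bot I |>.2 h0)
  have h2 : ⁅I, I⁆ = I := (hI.le_iff.1 (LieSubmodule.lie_le_left I I)).resolve_left h1
  calc I = ⁅I, I⁆ := h2.symm
    _ ≤ _ := by
      rw [hL.sSup_atoms_eq_top]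
      exact LieSubmodule.mono_lie le_top le_top

/-- The trace kills commutators, and these span a semisimple algebra. -/
lemma trace_eq_zero_of_isSemisimple {n : ℕ} {𝔤 : LieSubalgebra ℝ (Matrix (Fin n) (Fin n) ℂ)}
    (h𝔤 : LieAlgebra.IsSemisimple ℝ 𝔤) {X : Matrix (Fin n) (Fin n) ℂ} (hX : X ∈ 𝔤) :
    X.trace = 0 := by
  let τ : 𝔤 →ₗ[ℝ] ℂ := (Matrix.traceLinearMap (Fin n) ℝ ℂ).comp 𝔤.toSubmodule.subtype
  have h1 : (⁅(⊤ : LieIdeal ℝ 𝔤), (⊤ : LieIdeal ℝ 𝔤)⁆ : LieIdeal ℝ 𝔤).toSubmodule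
      ≤ LinearMap.ker τ := by
    rw [LieSubmodule.lieIdeal_oper_eq_linear_span', Submodule.span_le]
    rintro _ ⟨x, -, y, -, rfl⟩
    change Matrix.trace ((⁅x, y⁆ : 𝔤) : Matrix (Fin n) (Fin n) ℂ) = 0
    rw [LieSubalgebra.coe_bracket, LieRing.of_associative_ring_bracket, Matrix.trace_sub,
      Matrix.trace_mul_comm, sub_self]
  rw [lie_top_eq_top_of_isSemisimple h𝔤] at h1
  exact h1 (show (⟨X, hX⟩ : 𝔤) ∈ (⊤ : LieIdeal ℝ 𝔤).toSubmodule from trivial)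

section Mat

variable {n : ℕ} {G : Subgroup (GL (Fin n) ℂ)}

lemma mat_one : mat (1 : G) = 1 := rfl

lemma mat_mul (a b : G) : mat (a * b) = mat a * mat b := rfl

lemma mat_mul_mat_inv (a : G) : mat a * mat a⁻¹ = 1 := by
  rw [← mat_mul, mul_inv_cancel, mat_one]

lemma mat_inv_mul_mat (a : G) : mat a⁻¹ * mat a = 1 := by
  rw [← mat_mul, inv_mul_cancel, mat_one]

lemma mat_inv_eq_adjugate {a : G} (ha : (mat a).det = 1) : mat a⁻¹ = (mat a).adjugate := by
  have h1 : mat a * (mat a).adjugate = 1 := by rw [Matrix.mul_adjugate, ha, one_smul]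
  calc mat a⁻¹ = mat a⁻¹ * (mat a * (mat a).adjugate) := by rw [h1, mul_one]
    _ = (mat a).adjugate := by rw [← mul_assoc, mat_inv_mul_mat, one_mul]

end Mat

lemma det_mat_eq_one {n : ℕ} {𝔤 : LieSubalgebra ℝ (Matrix (Fin n) (Fin n) ℂ)}
    (h𝔤 : LieAlgebra.IsSemisimple ℝ 𝔤) (g : matrixGroup 𝔤) : (mat g).det = 1 := by
  obtain ⟨g, hg⟩ := g
  change ((g : Matrix (Fin n) (Fin n) ℂ)).det = 1
  induction hg using Subgroup.closure_induction with
  | mem x hx =>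
    obtain ⟨X, hX, hx⟩ := hx
    rw [hx]
    exact det_exp_of_trace_eq_zero (trace_eq_zero_of_isSemisimple h𝔤 hX)
  | one => simp
  | mul x y _ _ hx hy => rw [Units.val_mul, Matrix.det_mul, hx, hy, one_mul]
  | inv x _ hx =>
    have h1 : ((x⁻¹ : GL (Fin n) ℂ) : Matrix (Fin n) (Fin n) ℂ) * x = 1 := by
      rw [← Units.val_mul, inv_mul_cancel, Units.val_one]
    have h2 := congrArg Matrix.det h1
    rwa [Matrix.det_mul, hx, mul_one, Matrix.det_one] at h2

/-! ### Matrices over rings of functions -/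

/-- Stated for an arbitrary ring of functions so as to apply at once to `C^r` functions, functions
differentiable at a point, and Laurent polynomials. -/
lemma mul_apply_mem {n : ℕ} {X : Type*} (A : Subring (X → ℂ))
    {f g : X → Matrix (Fin n) (Fin n) ℂ} (hf : ∀ i j, (fun x => f x i j) ∈ A)
    (hg : ∀ i j, (fun x => g x i j) ∈ A) (i j : Fin n) : (fun x => (f x * g x) i j) ∈ A := by
  have h1 : (fun x => (f x * g x) i j) = ∑ k, (fun x => f x i k) * (fun x => g x k j) := by
    ext x
    simp [Matrix.mul_apply]
  rw [h1]
  exact A.sum_mem fun k _ => A.mul_mem (hf i k) (hg k j)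

/-- The adjugate can be formed over `A` itself, and evaluation at a point is a ring homomorphism, so
it commutes with the adjugate. -/
lemma adjugate_apply_mem {n : ℕ} {X : Type*} (A : Subring (X → ℂ))
    {f : X → Matrix (Fin n) (Fin n) ℂ} (hf : ∀ i j, (fun x => f x i j) ∈ A) (i j : Fin n) :
    (fun x => (f x).adjugate i j) ∈ A := by
  let M : Matrix (Fin n) (Fin n) A := Matrix.of fun i j => ⟨fun x => f x i j, hf i j⟩
  have h1 : (fun x => (f x).adjugate i j) = (M.adjugate i j : X → ℂ) := by
    ext x
    exact congrFun (congrFun (RingHom.map_adjugate ((Pi.evalRingHom (fun _ => ℂ) x).comp A.subtype)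
      M) i) j |>.symm
  rw [h1]
  exact (M.adjugate i j).2

lemma mat_inv_apply_mem {n : ℕ} {G : Subgroup (GL (Fin n) ℂ)} {X : Type*} (A : Subring (X → ℂ))
    {f : X → G} (hdet : ∀ x, (mat (f x)).det = 1) (hf : ∀ i j, (fun x => mat (f x) i j) ∈ A)
    (i j : Fin n) : (fun x => mat (f x)⁻¹ i j) ∈ A := by
  simp only [mat_inv_eq_adjugate (hdet _)]
  exact adjugate_apply_mem A hf i j

/-- Functions of class `C^r` on the line form a ring. -/
def contDiffSubring (r : WithTop ℕ∞) : Subring (ℝ → ℂ) where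
  carrier := {f | ContDiff ℝ r f}
  mul_mem' := ContDiff.mul
  one_mem' := contDiff_const
  add_mem' := ContDiff.add
  zero_mem' := contDiff_const
  neg_mem' := ContDiff.neg

lemma inv_mem_basedLoops {n : ℕ} {r : WithTop ℕ∞} {G : Subgroup (GL (Fin n) ℂ)} {γ : Circle → G}
    (hdet : ∀ g : G, (mat g).det = 1) (hγ : γ ∈ basedLoops r G) :
    (fun l => (γ l)⁻¹) ∈ basedLoops r G :=
  ⟨mat_inv_apply_mem (contDiffSubring r) (fun _ => hdet _) hγ.1, by simp [hγ.2]⟩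

/-! ### Locally constant functions off a finite set -/

/-- The punctured disc is the image of the punctured plane under a homeomorphism from the plane to
the disc. -/
lemma isPreconnected_ball_diff_singleton (c : ℂ) {ε : ℝ} (hε : 0 < ε) :
    IsPreconnected (Metric.ball c ε \ {c}) := by
  have h1 : OpenPartialHomeomorph.univBall c ε '' {0}ᶜ = Metric.ball c ε \ {c} := by
    have hs := OpenPartialHomeomorph.univBall_source c ε
    have h2 : OpenPartialHomeomorph.univBall c ε '' {0}ᶜ
        = OpenPartialHomeomorph.univBall c ε '' Set.univ \ OpenPartialHomeomorph.univBall c ε '' {0} := by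
      rw [Set.compl_eq_univ_sdiff]
      exact (Set.InjOn.image_sdiff_subset (hs ▸ (OpenPartialHomeomorph.univBall c ε).injOn)
        (Set.subset_univ _))
    rw [h2, Set.image_singleton, OpenPartialHomeomorph.univBall_apply_zero, ← hs,
      OpenPartialHomeomorph.image_source_eq_target, OpenPartialHomeomorph.univBall_target c hε]
  rw [← h1]
  refine (isConnected_compl_singleton_of_one_lt_rank ?_ (0 : ℂ)).isPreconnected.image _
    (OpenPartialHomeomorph.continuous_univBall c ε).continuousOn
  simp

section Surface

variable {X : Type*} [TopologicalSpace X] [ChartedSpace ℂ X]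

lemma neBot_nhdsNE (x : X) : (nhdsWithin x {x}ᶜ).NeBot := by
  have hx := mem_chart_source ℂ x
  have h1 : Filter.Tendsto (chartAt ℂ x).symm (nhdsWithin (chartAt ℂ x x) {chartAt ℂ x x}ᶜ)
      (nhdsWithin x {x}ᶜ) := by
    refine tendsto_nhdsWithin_iff.2 ⟨?_, ?_⟩
    · have := (chartAt ℂ x).continuousAt_symm (mem_chart_target ℂ x)
      rw [ContinuousAt, (chartAt ℂ x).left_inv hx] at this
      exact this.mono_left nhdsWithin_le_nhds
    · filter_upwards [self_mem_nhdsWithin,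
        mem_nhdsWithin_of_mem_nhds ((chartAt ℂ x).open_target.mem_nhds (mem_chart_target ℂ x))]
        with w hw hw' h
      exact hw (by rw [← (chartAt ℂ x).right_inv hw', Set.mem_singleton_iff.1 h]; rfl)
  exact h1.neBot

variable [T2Space X]

/-- A small punctured coordinate disc around `x` misses `S` and is connected, so `f` is constant
there even if `x ∈ S`. -/
lemma exists_eventually_eq_of_locallyConstant {α : Type*} {S : Set X} (hS : S.Finite) {f : X → α}
    (hf : ∀ x ∉ S, ∀ᶠ y in nhds x, f y = f x) (x : X) :
    ∃ a, ∀ᶠ y in nhdsWithin x {x}ᶜ, f y = a := by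
  set φ := chartAt ℂ x
  have hx : x ∈ φ.source := mem_chart_source ℂ x
  have hT : IsOpen (S \ {x})ᶜ := (hS.subset Set.sdiff_subset).isClosed.isOpen_compl
  have h1 : φ.target ∩ φ.symm ⁻¹' (S \ {x})ᶜ ∈ nhds (φ x) :=
    (φ.isOpen_inter_preimage_symm hT).mem_nhds ⟨mem_chart_target ℂ x, by
      simp [φ.left_inv hx]⟩
  obtain ⟨ε, hε, hball⟩ := Metric.mem_nhds_iff.1 h1
  have hpt : φ x + (ε / 2 : ℝ) ∈ Metric.ball (φ x) ε \ {φ x} := by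
    refine ⟨?_, ?_⟩
    · simp only [Metric.mem_ball, dist_self_add_left, Complex.norm_real, Real.norm_eq_abs]
      rw [abs_of_pos (half_pos hε)]
      exact half_lt_self hε
    · simp [hε.ne']
  -- With the discrete topology on `α`, local constancy becomes continuity.
  let : TopologicalSpace α := ⊥
  have hdisc : DiscreteTopology α := ⟨rfl⟩
  have hcont : ContinuousOn (f ∘ φ.symm) (Metric.ball (φ x) ε \ {φ x}) := by
    intro w hw
    have hw1 := hball hw.1
    have hne : φ.symm w ≠ x := fun h => hw.2 (by rw [← h, φ.right_inv hw1.1]; rfl)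
    have hwS : φ.symm w ∉ S := fun h => hw1.2 ⟨h, hne⟩
    refine ContinuousAt.continuousWithinAt ?_
    have h2 : Filter.Tendsto f (nhds (φ.symm w)) (nhds (f (φ.symm w))) := by
      rw [nhds_discrete α, Filter.tendsto_pure]
      exact hf _ hwS
    exact Filter.Tendsto.comp h2 (φ.continuousAt_symm hw1.1)
  refine ⟨f (φ.symm (φ x + (ε / 2 : ℝ))), ?_⟩
  filter_upwards [self_mem_nhdsWithin, mem_nhdsWithin_of_mem_nhds (φ.open_source.mem_nhds hx),
    mem_nhdsWithin_of_mem_nhds ((φ.continuousAt hx).preimage_mem_nhds (Metric.ball_mem_nhds _ hε))]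
    with y hy hy1 hy2
  have h3 : φ y ∈ Metric.ball (φ x) ε \ {φ x} := ⟨hy2, fun h => hy (φ.injOn hy1 hx h)⟩
  have h4 := (isPreconnected_ball_diff_singleton (φ x) hε).constant_of_mapsTo
    (isDiscrete_univ_iff.2 hdisc) hcont (Set.mapsTo_univ _ _) h3 hpt
  simpa [φ.left_inv hy1] using h4

/-- The punctured limit `g` of `f` exists at every point, agrees with `f` off `S`, and is locally
constant on all of `X`. -/
lemma eq_of_locallyConstant_off_finite [PreconnectedSpace X] {α : Type*} {S : Set X}
    (hS : S.Finite) {f : X → α} (hf : ∀ x ∉ S, ∀ᶠ y in nhds x, f y = f x) {x y : X} (hx : x ∉ S)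
    (hy : y ∉ S) : f x = f y := by
  have := neBot_nhdsNE (X := X)
  choose g hg using exists_eventually_eq_of_locallyConstant hS hf
  have hgf : ∀ z ∉ S, g z = f z := fun z hz => by
    obtain ⟨w, hw1, hw2⟩ := ((hg z).and (mem_nhdsWithin_of_mem_nhds (hf z hz))).exists
    exact hw1.symm.trans hw2
  have hloc : IsLocallyConstant g := by
    rw [IsLocallyConstant.iff_eventually_eq]
    intro z
    have h1 : ∀ᶠ w in nhds z, w ≠ z → f w = g z ∧ w ∉ S := by
      have h2 : ∀ᶠ w in nhdsWithin z {z}ᶜ, w ∉ S := by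
        have h3 : (S \ {z})ᶜ ∈ nhds z :=
          (hS.subset Set.sdiff_subset).isClosed.isOpen_compl.mem_nhds (by simp)
        filter_upwards [mem_nhdsWithin_of_mem_nhds h3, self_mem_nhdsWithin] with w hw hw' hwS
        exact hw ⟨hwS, hw'⟩
      exact eventually_nhdsWithin_iff.1 ((hg z).and h2)
    filter_upwards [h1] with w hw
    by_cases hwz : w = z
    · rw [hwz]
    · rw [hgf w (hw hwz).2, (hw hwz).1]
  rw [← hgf x hx, ← hgf y hy]
  exact hloc.apply_eq_of_preconnectedSpace x y

lemma dense_compl_of_finite {S : Set X} (hS : S.Finite) : Dense Sᶜ := by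
  have := neBot_nhdsNE (X := X)
  rw [Set.compl_eq_univ_sdiff]
  exact dense_univ.sdiff_finite hS

end Surface

/-! ### Calculus of the real differential -/

section Calculus

variable {n : ℕ} {X : Type*} [TopologicalSpace X] [ChartedSpace ℂ X]

/-- Complex functions that are real differentiable at a point form a ring. -/
def mdiffSubring (x : X) : Subring (X → ℂ) where
  carrier := {f | MDifferentiableAt 𝓘(ℝ, ℂ) 𝓘(ℝ, ℂ) f x}
  mul_mem' := MDifferentiableAt.mul
  one_mem' := mdifferentiableAt_const
  add_mem' := MDifferentiableAt.add
  zero_mem' := mdifferentiableAt_const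
  neg_mem' := MDifferentiableAt.neg

/-- Entrywise real differentiability of a matrix-valued function at a point. -/
def MatMDiffAt (f : X → Matrix (Fin n) (Fin n) ℂ) (x : X) : Prop :=
  ∀ i j, (fun y => f y i j) ∈ mdiffSubring x

lemma MatMDiffAt.mul {f g : X → Matrix (Fin n) (Fin n) ℂ} {x : X} (hf : MatMDiffAt f x)
    (hg : MatMDiffAt g x) : MatMDiffAt (fun y => f y * g y) x :=
  mul_apply_mem _ hf hg

lemma matMDiffAt_const (A : Matrix (Fin n) (Fin n) ℂ) (x : X) : MatMDiffAt (fun _ => A) x :=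
  fun _ _ => mdifferentiableAt_const

lemma SmoothOn.matMDiffAt {f : X → Matrix (Fin n) (Fin n) ℂ} {D : Set X} (hf : SmoothOn f D)
    (hD : IsOpen D) {x : X} (hx : x ∈ D) : MatMDiffAt f x := fun i j =>
  ((hf i j x hx).contMDiffAt (hD.mem_nhds hx)).mdifferentiableAt (by simp)

lemma rdiff_apply (f : X → Matrix (Fin n) (Fin n) ℂ) (x : X) (v : ℂ) (i j : Fin n) :
    rdiff f x v i j = (mfderiv 𝓘(ℝ, ℂ) 𝓘(ℝ, ℂ) (fun y => f y i j) x : ℂ →L[ℝ] ℂ) v := rfl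

lemma rdiff_const (A : Matrix (Fin n) (Fin n) ℂ) (x : X) (v : ℂ) :
    rdiff (fun _ => A) x v = 0 := by
  ext i j
  rw [rdiff_apply, mfderiv_const]
  rfl

lemma rdiff_congr {f g : X → Matrix (Fin n) (Fin n) ℂ} {x : X} (h : ∀ᶠ y in nhds x, f y = g y)
    (v : ℂ) : rdiff f x v = rdiff g x v := by
  ext i j
  have h1 : (fun y => f y i j) =ᶠ[nhds x] fun y => g y i j := by
    filter_upwards [h] with y hy
    rw [hy]
  exact DFunLike.congr_fun h1.mfderiv_eq v

lemma rdiff_mul {f g : X → Matrix (Fin n) (Fin n) ℂ} {x : X} (hf : MatMDiffAt f x)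
    (hg : MatMDiffAt g x) (v : ℂ) :
    rdiff (fun y => f y * g y) x v = rdiff f x v * g x + f x * rdiff g x v := by
  ext i j
  have h1 : (fun y => (f y * g y) i j) = ∑ k, (fun y => f y i k) * (fun y => g y k j) := by
    ext y
    simp [Matrix.mul_apply]
  let A : Fin n → ℂ →L[ℝ] ℂ := fun k => mfderiv 𝓘(ℝ, ℂ) 𝓘(ℝ, ℂ) (fun y => f y i k) x
  let B : Fin n → ℂ →L[ℝ] ℂ := fun k => mfderiv 𝓘(ℝ, ℂ) 𝓘(ℝ, ℂ) (fun y => g y k j) x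
  have h2 : HasMFDerivAt 𝓘(ℝ, ℂ) 𝓘(ℝ, ℂ) (fun y => (f y * g y) i j) x
      (∑ k, (f x i k • B k + g x k j • A k) : ℂ →L[ℝ] ℂ) := by
    rw [h1]
    exact HasMFDerivAt.sum fun k _ => (MDifferentiableAt.hasMFDerivAt (hf i k)).mul
      (MDifferentiableAt.hasMFDerivAt (hg k j))
  have h3 : ∀ C : Fin n → ℂ →L[ℝ] ℂ, (∑ k, C k) v = ∑ k, C k v := fun C => by
    rw [sum_apply]
  refine (DFunLike.congr_fun h2.mfderiv v).trans ((h3 _).trans ?_)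
  simp only [Matrix.add_apply, Matrix.mul_apply]
  rw [← Finset.sum_add_distrib]
  refine Finset.sum_congr rfl fun k _ => ?_
  change f x i k * rdiff g x v k j + g x k j * rdiff f x v i k = _
  ring

lemma MatMDiffAt.mat_inv {G : Subgroup (GL (Fin n) ℂ)} {f : X → G} {x : X}
    (hdet : ∀ g : G, (mat g).det = 1) (hf : MatMDiffAt (fun y => mat (f y)) x) :
    MatMDiffAt (fun y => mat (f y)⁻¹) x :=
  mat_inv_apply_mem _ (fun _ => hdet _) hf

/-- Differentiate `f f⁻¹ = 1`. -/
lemma rdiff_mat_inv {G : Subgroup (GL (Fin n) ℂ)} {f : X → G} {x : X}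
    (hdet : ∀ g : G, (mat g).det = 1) (hf : MatMDiffAt (fun y => mat (f y)) x) (v : ℂ) :
    rdiff (fun y => mat (f y)⁻¹) x v
      = -(mat (f x)⁻¹ * rdiff (fun y => mat (f y)) x v * mat (f x)⁻¹) := by
  have h1 := rdiff_mul hf (hf.mat_inv hdet) v
  simp only [mat_mul_mat_inv, rdiff_const] at h1
  have h2 := congrArg (fun A => mat (f x)⁻¹ * A) h1
  simp only [mul_zero, mul_add, ← mul_assoc, mat_inv_mul_mat, one_mul] at h2
  exact eq_neg_of_add_eq_zero_right h2.symm

lemma part10_add_part01 (L : ℂ → Matrix (Fin n) (Fin n) ℂ) (v : ℂ) :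
    part10 L v + part01 L v = L v := by
  rw [part10, part01, ← smul_add, sub_add_add_cancel, ← two_smul ℂ (L v), smul_smul]
  norm_num

lemma isManifold_real [IsManifold 𝓘(ℂ) ω X] : IsManifold 𝓘(ℝ, ℂ) 1 X := by
  refine isManifold_of_contDiffOn _ _ _ fun e e' he he' => ?_
  have h1 : e.symm ≫ₕ e' ∈ contDiffGroupoid ω 𝓘(ℂ) := (contDiffGroupoid ω 𝓘(ℂ)).compatible he he'
  rw [contDiffGroupoid, mem_groupoid_of_pregroupoid] at h1
  have h2 : ContDiffOn ℂ ω (𝓘(ℂ) ∘ (e.symm ≫ₕ e') ∘ 𝓘(ℂ).symm)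
    (𝓘(ℂ).symm ⁻¹' (e.symm ≫ₕ e').source ∩ Set.range 𝓘(ℂ)) := h1.1
  exact (h2.restrict_scalars ℝ).of_le le_top

lemma eventually_eq_of_mfderiv_eq_zero [IsManifold 𝓘(ℂ) ω X] {f : X → ℂ} {x : X}
    (hf : ∀ᶠ y in nhds x, MDifferentiableAt 𝓘(ℝ, ℂ) 𝓘(ℝ, ℂ) f y ∧
      mfderiv 𝓘(ℝ, ℂ) 𝓘(ℝ, ℂ) f y = 0) : ∀ᶠ y in nhds x, f y = f x := by
  have := isManifold_real (X := X)
  set φ := chartAt ℂ x with hφ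
  have hx : x ∈ φ.source := mem_chart_source ℂ x
  have h1 : φ.target ∩ φ.symm ⁻¹' {y | MDifferentiableAt 𝓘(ℝ, ℂ) 𝓘(ℝ, ℂ) f y ∧
      mfderiv 𝓘(ℝ, ℂ) 𝓘(ℝ, ℂ) f y = 0} ∈ nhds (φ x) := by
    refine Filter.inter_mem (φ.open_target.mem_nhds (mem_chart_target ℂ x)) ?_
    refine (φ.continuousAt_symm (mem_chart_target ℂ x)).preimage_mem_nhds ?_
    rwa [φ.left_inv hx]
  obtain ⟨ε, hε, hball⟩ := Metric.mem_nhds_iff.1 h1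
  have hd : ∀ w ∈ Metric.ball (φ x) ε, HasFDerivAt (𝕜 := ℝ) (f ∘ φ.symm) 0 w := by
    intro w hw
    obtain ⟨hw1, hw2, hw3⟩ := hball hw
    have h2 := mdifferentiableAt_atlas_symm (I := 𝓘(ℝ, ℂ)) (chart_mem_atlas ℂ x) hw1
    have h3 := hw2.hasMFDerivAt.comp w h2.hasMFDerivAt
    rw [hw3] at h3
    have h4 := h3.hasFDerivAt
    have h5 : (0 : TangentSpace 𝓘(ℝ, ℂ) (φ.symm w) →L[ℝ] ℂ).comp
        (mfderiv 𝓘(ℝ, ℂ) 𝓘(ℝ, ℂ) (chartAt ℂ x).symm w) = 0 := ContinuousLinearMap.zero_comp _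
    exact h5 ▸ h4
  filter_upwards [φ.open_source.mem_nhds hx,
    (φ.continuousAt hx).preimage_mem_nhds (Metric.ball_mem_nhds _ hε)] with y hy1 hy2
  have h5 := Metric.isOpen_ball.is_const_of_fderiv_eq_zero (𝕜 := ℝ) Metric.isPreconnected_ball
    (fun w hw => (hd w hw).differentiableAt.differentiableWithinAt) (fun w hw => (hd w hw).fderiv)
    hy2 (Metric.mem_ball_self hε)
  simpa [φ.left_inv hy1, φ.left_inv hx] using h5

lemma eventually_eq_of_rdiff_eq_zero [IsManifold 𝓘(ℂ) ω X] {f : X → Matrix (Fin n) (Fin n) ℂ}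
    {x : X} (hf : ∀ᶠ y in nhds x, MatMDiffAt f y ∧ ∀ v, rdiff f y v = 0) :
    ∀ᶠ y in nhds x, f y = f x := by
  have h1 : ∀ i j, ∀ᶠ y in nhds x, f y i j = f x i j := fun i j =>
    eventually_eq_of_mfderiv_eq_zero <| hf.mono fun y hy =>
      ⟨hy.1 i j, ContinuousLinearMap.ext fun v => congrFun (congrFun (hy.2 v) i) j⟩
  filter_upwards [Filter.eventually_all.2 fun i => Filter.eventually_all.2 (h1 i)] with y hy
  ext i j
  exact hy i j

end Calculus

/-! ### Laurent polynomials -/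

/-- Functions that are Laurent polynomials in `λ`, of degree bounded uniformly in `z ∈ D`. -/
def laurentSubring {X : Type*} (D : Set X) : Subring (X × Circle → ℂ) where
  carrier := {f | ∃ N : ℕ, ∀ z ∈ D, ∃ P : Polynomial ℂ, P.natDegree ≤ 2 * N ∧
    ∀ l : Circle, (l : ℂ) ^ N * f (z, l) = P.eval (l : ℂ)}
  mul_mem' := by
    rintro f g ⟨N, hf⟩ ⟨N', hg⟩
    refine ⟨N + N', fun z hz => ?_⟩
    obtain ⟨P, hP, hP'⟩ := hf z hz
    obtain ⟨Q, hQ, hQ'⟩ := hg z hz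
    refine ⟨P * Q, Polynomial.natDegree_mul_le.trans (by omega), fun l => ?_⟩
    rw [Polynomial.eval_mul, ← hP', ← hQ', Pi.mul_apply]
    ring
  one_mem' := ⟨0, fun _ _ => ⟨1, by simp, by simp⟩⟩
  add_mem' := by
    rintro f g ⟨N, hf⟩ ⟨N', hg⟩
    refine ⟨N + N', fun z hz => ?_⟩
    obtain ⟨P, hP, hP'⟩ := hf z hz
    obtain ⟨Q, hQ, hQ'⟩ := hg z hz
    -- Both summands are brought to the common denominator `λ^(N + N')`.
    refine ⟨Polynomial.X ^ N' * P + Polynomial.X ^ N * Q, ?_, fun l => ?_⟩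
    · refine Polynomial.natDegree_add_le_of_degree_le ?_ ?_ <;>
        refine Polynomial.natDegree_mul_le.trans ?_ <;> rw [Polynomial.natDegree_X_pow] <;> omega
    · simp only [Polynomial.eval_add, Polynomial.eval_mul, Polynomial.eval_pow, Polynomial.eval_X,
        ← hP', ← hQ', Pi.add_apply]
      ring
  zero_mem' := ⟨0, fun _ _ => ⟨0, by simp, by simp⟩⟩
  neg_mem' := by
    rintro f ⟨N, hf⟩
    refine ⟨N, fun z hz => ?_⟩
    obtain ⟨P, hP, hP'⟩ := hf z hz
    exact ⟨-P, by simpa using hP, fun l => by simp [← hP']⟩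

lemma mem_laurentSubring_of_const {X : Type*} (D : Set X) (a : X → ℂ) :
    (fun p : X × Circle => a p.1) ∈ laurentSubring D :=
  ⟨0, fun z _ => ⟨Polynomial.C (a z), by simp, by simp⟩⟩

lemma mem_laurentSubring_comp {X Y : Type*} {D : Set X} {E : Set Y} {f : X × Circle → ℂ}
    (hf : f ∈ laurentSubring D) (s : Y → X) (hs : Set.MapsTo s E D) :
    (fun p : Y × Circle => f (s p.1, p.2)) ∈ laurentSubring E :=
  let ⟨N, h⟩ := hf
  ⟨N, fun y hy => h (s y) (hs hy)⟩

lemma eval_eq_sum_Icc {P : Polynomial ℂ} {N : ℕ} (hP : P.natDegree ≤ 2 * N) (l : Circle) :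
    P.eval (l : ℂ) = (l : ℂ) ^ N *
      ∑ k ∈ Finset.Icc (-(N : ℤ)) N, (l : ℂ) ^ k * P.coeff (k + N).toNat := by
  have hl : (l : ℂ) ≠ 0 := l.coe_ne_zero
  rw [Polynomial.eval_eq_sum_range' (Nat.lt_succ_of_le hP), Finset.mul_sum]
  refine (Finset.sum_nbij' (fun k : ℤ => (k + N).toNat) (fun m : ℕ => (m : ℤ) - N) ?_ ?_ ?_ ?_ ?_).symm
  · intro k hk
    simp only [Finset.mem_Icc, Finset.mem_range] at *
    omega
  · intro k hk
    simp only [Finset.mem_Icc, Finset.mem_range] at *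
    omega
  · intro k hk
    simp only [Finset.mem_Icc] at *
    omega
  · intro k hk
    simp
  · intro k hk
    simp only [Finset.mem_Icc] at hk
    rw [← mul_assoc, ← zpow_natCast, ← zpow_natCast, ← zpow_add₀ hl, mul_comm,
      Int.toNat_of_nonneg (by omega), add_comm k]

lemma isLaurentOn_iff {n : ℕ} {G : Subgroup (GL (Fin n) ℂ)} {X : Type*} {D : Set X}
    {f : X → Circle → G} :
    IsLaurentOn D f ↔
      ∀ i j, (fun p : X × Circle => mat (f p.1 p.2) i j) ∈ laurentSubring D := by
  constructor
  · rintro ⟨N, c, h⟩ i j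
    refine ⟨N, fun z hz => ⟨∑ m ∈ Finset.range (2 * N + 1),
      Polynomial.monomial m (c ((m : ℤ) - N) z i j), ?_, fun l => ?_⟩⟩
    · refine Polynomial.natDegree_sum_le_of_forall_le _ _ fun m hm => ?_
      exact (Polynomial.natDegree_monomial_le _).trans (by simp at hm; omega)
    · rw [eval_eq_sum_Icc (N := N)]
      · change (l : ℂ) ^ N * mat (f z l) i j = _
        rw [h z hz l, Matrix.sum_apply]
        congr 1
        refine Finset.sum_congr rfl fun k hk => ?_
        simp only [Finset.mem_Icc] at hk
        rw [Matrix.smul_apply, smul_eq_mul, Polynomial.finsetSum_coeff]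
        simp only [Polynomial.coeff_monomial]
        rw [Finset.sum_ite_eq', if_pos (Finset.mem_range.2 (by omega)),
          Int.toNat_of_nonneg (by omega), add_sub_cancel_right]
      · refine Polynomial.natDegree_sum_le_of_forall_le _ _ fun m hm => ?_
        exact (Polynomial.natDegree_monomial_le _).trans (by simp at hm; omega)
  · intro h
    choose N hN using h
    have hle : ∀ i j, N i j ≤ ∑ i, ∑ j, N i j := fun i j =>
      (Finset.single_le_sum (f := fun j => N i j) (fun _ _ => Nat.zero_le _)
        (Finset.mem_univ j)).trans
      (Finset.single_le_sum (f := fun i => ∑ j, N i j) (fun _ _ => Nat.zero_le _)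
        (Finset.mem_univ i))
    set N₀ := ∑ i, ∑ j, N i j
    -- All entries are rewritten with the one exponent `N₀`. Membership in `D` sits inside the
    -- existential so that `choose` gives coefficients defined for every `z`.
    have h1 : ∀ z i j, ∃ P : Polynomial ℂ, z ∈ D → P.natDegree ≤ 2 * N₀ ∧
        ∀ l : Circle, (l : ℂ) ^ N₀ * mat (f z l) i j = P.eval (l : ℂ) := by
      intro z i j
      by_cases hz : z ∈ D
      · obtain ⟨P, hP, hP'⟩ := hN i j z hz
        have hij := hle i j
        refine ⟨Polynomial.X ^ (N₀ - N i j) * P, fun _ => ⟨?_, fun l => ?_⟩⟩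
        · refine Polynomial.natDegree_mul_le.trans ?_
          rw [Polynomial.natDegree_X_pow]
          omega
        · rw [Polynomial.eval_mul, ← hP', Polynomial.eval_pow, Polynomial.eval_X, ← mul_assoc,
            ← pow_add, Nat.sub_add_cancel hij]
      · exact ⟨0, fun hz' => absurd hz' hz⟩
    choose P hP using h1
    refine ⟨N₀, fun k z => Matrix.of fun i j => (P z i j).coeff (k + N₀).toNat,
      fun z hz l => ?_⟩
    ext i j
    obtain ⟨hdeg, hev⟩ := hP z i j hz
    refine mul_left_cancel₀ (pow_ne_zero N₀ l.coe_ne_zero) ?_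
    rw [hev l, eval_eq_sum_Icc hdeg, Matrix.sum_apply]
    rfl

/-- Since the degree bound is uniform on `D`, interpolation at fixed points of the circle gives a
polynomial for every `z`, with values continuous in `z`. It represents `f` on `D`, hence everywhere.
-/
lemma mem_laurentSubring_univ_of_dense {X : Type*} [TopologicalSpace X] {D : Set X} (hD : Dense D)
    {f : X × Circle → ℂ} (hf : ∀ l : Circle, Continuous fun z => f (z, l))
    (h : f ∈ laurentSubring D) : f ∈ laurentSubring Set.univ := by
  classical
  obtain ⟨N, hN⟩ := h
  have hC : Infinite Circle := by
    have := (Set.Ioc_infinite (neg_lt_self Real.pi_pos)).to_subtype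
    exact Circle.argEquiv.infinite_iff.2 this
  -- A polynomial of degree at most `2N` is determined by `2N + 1` values.
  obtain ⟨s, hs⟩ := Infinite.exists_subset_card_eq Circle (2 * N + 1)
  have hinj : Set.InjOn (fun l : Circle => (l : ℂ)) s := Circle.coe_injective.injOn
  let P : X → Polynomial ℂ := fun z =>
    Lagrange.interpolate s (fun l : Circle => (l : ℂ)) fun l => (l : ℂ) ^ N * f (z, l)
  refine ⟨N, fun z _ => ⟨P z, ?_, fun l => ?_⟩⟩
  · have h1 := Lagrange.degree_interpolate_lt (r := fun l : Circle => (l : ℂ) ^ N * f (z, l)) hinj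
    rw [hs] at h1
    exact Polynomial.natDegree_le_iff_coeff_eq_zero.2 fun m hm =>
      (Polynomial.degree_lt_iff_coeff_zero _ _).1 h1 m hm
  · have h2 : (fun z => (l : ℂ) ^ N * f (z, l)) = fun z => (P z).eval (l : ℂ) := by
      refine Continuous.ext_on hD (continuous_const.mul (hf l)) ?_ fun z hz => ?_
      · simp only [P, Lagrange.interpolate_apply, Polynomial.eval_finsetSum, Polynomial.eval_mul,
          Polynomial.eval_C]
        exact continuous_finsetSum _ fun m _ =>
          (continuous_const.mul (hf m)).mul continuous_const
      · obtain ⟨Q, hQ, hQ'⟩ := hN z hz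
        have h3 : Q = P z := by
          refine Lagrange.eq_interpolate_of_eval_eq _ hinj ?_ fun m _ => (hQ' m).symm
          rw [hs]
          exact (Polynomial.degree_le_of_natDegree_le hQ).trans_lt (by exact_mod_cast Nat.lt_succ_self _)
        simp only [hQ', h3]
    exact congrFun h2 z

lemma mem_laurentSubring_congr {X : Type*} {D : Set X} {f g : X × Circle → ℂ}
    (hf : f ∈ laurentSubring D) (h : ∀ z ∈ D, ∀ l, g (z, l) = f (z, l)) : g ∈ laurentSubring D :=
  let ⟨N, hN⟩ := hf
  ⟨N, fun z hz => let ⟨P, hP, hP'⟩ := hN z hz; ⟨P, hP, fun l => by rw [h z hz, hP']⟩⟩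

/-! ### Extended frames and extended solutions -/

section Frames

variable {n : ℕ} {G : Subgroup (GL (Fin n) ℂ)} {h : G}
  {X : Type*} [TopologicalSpace X] [ChartedSpace ℂ X]

lemma mat_injective : Function.Injective (mat : G → Matrix (Fin n) (Fin n) ℂ) :=
  Units.val_injective.comp Subtype.val_injective

lemma part10_smul_mul (c : ℂ) (P Q : Matrix (Fin n) (Fin n) ℂ)
    (L : ℂ → Matrix (Fin n) (Fin n) ℂ) (v : ℂ) :
    part10 (fun u => c • (P * L u * Q)) v = c • (P * part10 L v * Q) := by
  simp only [part10, Matrix.mul_smul, Matrix.smul_mul, mul_sub, sub_mul, smul_sub]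
  simp only [smul_smul, mul_comm c, mul_assoc]

lemma part01_smul_mul (c : ℂ) (P Q : Matrix (Fin n) (Fin n) ℂ)
    (L : ℂ → Matrix (Fin n) (Fin n) ℂ) (v : ℂ) :
    part01 (fun u => c • (P * L u * Q)) v = c • (P * part01 L v * Q) := by
  simp only [part01, Matrix.mul_smul, Matrix.smul_mul, mul_add, add_mul, smul_add]
  simp only [smul_smul, mul_comm c, mul_assoc]

lemma kPart_add_pPart (A : Matrix (Fin n) (Fin n) ℂ) : kPart h A + pPart h A = A := by
  rw [kPart, pPart, ← smul_add, add_add_sub_cancel, ← two_smul ℂ A, smul_smul]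
  norm_num

/-- Conjugation by `h²` is `σ² = id`. -/
lemma commute_sq_of_involution (hσ : ∀ g : G, symm h (symm h g) = g) (g : G) :
    h * h * g = g * (h * h) := by
  have h1 : h * (h * g * h⁻¹) * h⁻¹ = g := hσ g
  calc h * h * g = h * (h * g * h⁻¹) * h⁻¹ * (h * h) := by group
    _ = g * (h * h) := by rw [h1]

/-- Differentiate `h² f = f h²`. -/
lemma maurerCartan_commute_sq (hσ : ∀ g : G, symm h (symm h g) = g) {f : X → G} {z : X}
    (hf : MatMDiffAt (fun y => mat (f y)) z) (v : ℂ) :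
    mat h * mat h * maurerCartan f z v = maurerCartan f z v * (mat h * mat h) := by
  have h1 := rdiff_mul (matMDiffAt_const (mat h * mat h) z) hf v
  have h2 := rdiff_mul hf (matMDiffAt_const (mat h * mat h) z) v
  simp only [← mat_mul, commute_sq_of_involution hσ] at h1
  simp only [← mat_mul] at h2
  rw [h1] at h2
  simp only [rdiff_const, zero_mul, mul_zero, zero_add, add_zero] at h2
  rw [maurerCartan, ← mat_mul, ← mul_assoc, ← mat_mul, commute_sq_of_involution hσ, mat_mul,
    mul_assoc, h2, mul_assoc]

/-- For `φ = f h f⁻¹` and `α = f⁻¹ df`, the product rule gives `φ⁻¹ dφ = f (h⁻¹ α h - α) f⁻¹`. As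
`α` commutes with `h²`, `h⁻¹ α h = h α h⁻¹`, and the bracket is `-2 α_𝔭`. -/
lemma maurerCartan_conj (hdet : ∀ g : G, (mat g).det = 1)
    (hσ : ∀ g : G, symm h (symm h g) = g) {f φ : X → G} {z : X}
    (hf : MatMDiffAt (fun y => mat (f y)) z) (hφ : ∀ᶠ y in nhds z, φ y = f y * h * (f y)⁻¹)
    (v : ℂ) :
    maurerCartan φ z v =
      (-2 : ℂ) • (mat (f z) * pPart h (maurerCartan f z v) * mat (f z)⁻¹) := by
  have h1 : rdiff (fun y => mat (φ y)) z v
      = rdiff (fun y => mat (f y) * mat h * mat (f y)⁻¹) z v :=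
    rdiff_congr (hφ.mono fun y hy => by rw [hy, mat_mul, mat_mul]) v
  rw [rdiff_mul (hf.mul (matMDiffAt_const _ z)) (hf.mat_inv hdet),
    rdiff_mul hf (matMDiffAt_const _ z), rdiff_const, rdiff_mat_inv hdet hf] at h1
  have h2 : mat (φ z)⁻¹ = mat (f z) * mat h⁻¹ * mat (f z)⁻¹ := by
    rw [hφ.self_of_nhds, ← mat_mul, ← mat_mul]
    congr 1
    group
  have h3 : rdiff (fun y => mat (f y)) z v = mat (f z) * maurerCartan f z v := by
    rw [maurerCartan, ← mul_assoc, mat_mul_mat_inv, one_mul]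
  have h4 := maurerCartan_commute_sq hσ hf v
  rw [maurerCartan, h1, h2, h3]
  generalize maurerCartan f z v = α at h4
  have h5 : mat h⁻¹ * α * mat h = mat h * α * mat h⁻¹ := by
    calc mat h⁻¹ * α * mat h = mat h⁻¹ * (α * (mat h * mat h)) * mat h⁻¹ := by
          simp only [mul_assoc, mat_mul_mat_inv, mul_one]
      _ = mat h * α * mat h⁻¹ := by
          rw [← h4]
          simp only [← mul_assoc, mat_inv_mul_mat, one_mul]
  have h6 : (-2 : ℂ) • (mat (f z) * pPart h α * mat (f z)⁻¹)
      = mat (f z) * (mat h⁻¹ * α * mat h - α) * mat (f z)⁻¹ := by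
    rw [pPart, h5, Matrix.mul_smul, Matrix.smul_mul, smul_smul, ← Matrix.smul_mul,
      ← Matrix.mul_smul]
    congr 2
    norm_num
  rw [h6]
  have c1 : ∀ A, mat (f z)⁻¹ * (mat (f z) * A) = A := fun A => by
    rw [← mul_assoc, mat_inv_mul_mat, one_mul]
  have c2 : ∀ A, mat h⁻¹ * (mat h * A) = A := fun A => by
    rw [← mul_assoc, mat_inv_mul_mat, one_mul]
  simp only [mul_zero, add_zero, mul_add, mul_sub, sub_mul, mul_neg, mul_assoc, c1, c2]
  abel

lemma IsExtendedFrame.finite {r : WithTop ℕ∞} {𝓕 : X → G ⧸ fixSub h} {z₀ : X} {S : Set X}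
    {F : X → Circle → G} (hF : IsExtendedFrame r h 𝓕 z₀ S F) : S.Finite :=
  Set.finite_of_encard_le_coe hF.encard_le

/-- With `F₁ = F(·,1)` and `𝔸 = -F₁ α_𝔭 F₁⁻¹`, the term `dΦ F₁` equals `-Φ F₁ ((1 - λ⁻¹) α_𝔭' + (1 -
λ) α_𝔭'')`. Adding `Φ dF₁ = Φ F₁ α` cancels the parts free of `λ` except `α_𝔨`. -/
lemma rdiff_solution_mul_frame (hdet : ∀ g : G, (mat g).det = 1)
    (hσ : ∀ g : G, symm h (symm h g) = g) [T2Space X] {r : WithTop ℕ∞} {𝓕 : X → G ⧸ fixSub h}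
    {z₀ : X} {S : Set X} {F Φ : X → Circle → G} (hF : IsExtendedFrame r h 𝓕 z₀ S F)
    (hΦ : IsExtendedSolution r (cartan h ∘ 𝓕) Φ) {z : X} (hz : z ∉ S) (l : Circle) (v : ℂ) :
    rdiff (fun y => mat (Φ y l * F y 1)) z v =
      mat (Φ z l * F z 1) * alphaLoop h (maurerCartan (fun y => F y 1) z) l v := by
  have hS : IsOpen Sᶜ := hF.finite.isClosed.isOpen_compl
  have hF1 : MatMDiffAt (fun y => mat (F y 1)) z := (hF.smooth 1).matMDiffAt hS hz
  have hΦl : MatMDiffAt (fun y => mat (Φ y l)) z :=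
    (hΦ.smooth l).matMDiffAt isOpen_univ (Set.mem_univ z)
  have hφ : ∀ᶠ y in nhds z, (cartan h ∘ 𝓕) y = F y 1 * h * (F y 1)⁻¹ := by
    filter_upwards [hS.mem_nhds hz] with y hy
    rw [Function.comp_apply, ← hF.frame y hy]
    rfl
  have h1 : (fun u => (2⁻¹ : ℂ) • maurerCartan (cartan h ∘ 𝓕) z u) = fun u =>
      (-1 : ℂ) • (mat (F z 1) * pPart h (maurerCartan (fun y => F y 1) z u) * mat (F z 1)⁻¹) := by
    funext u
    rw [maurerCartan_conj hdet hσ hF1 hφ, smul_smul]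
    norm_num
  have h2 : rdiff (fun y => mat (F y 1)) z v
      = mat (F z 1) * maurerCartan (fun y => F y 1) z v := by
    rw [maurerCartan, ← mul_assoc, mat_mul_mat_inv, one_mul]
  have h3 := part10_add_part01 (rdiff (fun y => mat (Φ y l)) z) v
  rw [hΦ.eq10, hΦ.eq01, h1, part10_smul_mul, part01_smul_mul] at h3
  have h4 := rdiff_mul hΦl hF1 v
  simp only [← mat_mul] at h4
  rw [h4, ← h3, h2]
  rw [alphaLoop, mat_mul]
  have h5 : maurerCartan (fun y => F y 1) z v = kPart h (maurerCartan (fun y => F y 1) z v)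
      + (part10 (fun u => pPart h (maurerCartan (fun y => F y 1) z u)) v
      + part01 (fun u => pPart h (maurerCartan (fun y => F y 1) z u)) v) := by
    rw [part10_add_part01, kPart_add_pPart]
  conv_lhs => rw [h5]
  generalize part10 (fun u => pPart h (maurerCartan (fun y => F y 1) z u)) v = p
  generalize part01 (fun u => pPart h (maurerCartan (fun y => F y 1) z u)) v = q
  generalize kPart h (maurerCartan (fun y => F y 1) z v) = k
  simp only [neg_smul, one_smul, sub_smul, mul_neg, smul_neg, add_mul, mul_add, neg_mul, sub_mul,
    Matrix.mul_smul, Matrix.smul_mul, mul_assoc, mat_inv_mul_mat, mul_one]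
  abel

/-- Two solutions `Y` of `dY = Y α_λ` differ by a constant left factor. Here it is `Φ(z₀,λ)`, read
off at `z₀`, where `F` is the identity. -/
lemma solution_mul_frame_eq (hdet : ∀ g : G, (mat g).det = 1)
    (hσ : ∀ g : G, symm h (symm h g) = g) [T2Space X] [PreconnectedSpace X]
    [IsManifold 𝓘(ℂ) ω X] {r : WithTop ℕ∞} {𝓕 : X → G ⧸ fixSub h}
    {z₀ : X} {S : Set X} {F Φ : X → Circle → G} (hF : IsExtendedFrame r h 𝓕 z₀ S F)
    (hΦ : IsExtendedSolution r (cartan h ∘ 𝓕) Φ) {z : X} (hz : z ∉ S) (l : Circle) :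
    Φ z l * F z 1 = Φ z₀ l * F z l := by
  have hS : IsOpen Sᶜ := hF.finite.isClosed.isOpen_compl
  have hzero : ∀ y ∉ S, MatMDiffAt (fun y => mat (Φ y l * F y 1) * mat (F y l)⁻¹) y ∧
      ∀ v, rdiff (fun y => mat (Φ y l * F y 1) * mat (F y l)⁻¹) y v = 0 := by
    intro y hy
    have hFl : MatMDiffAt (fun y => mat (F y l)) y := (hF.smooth l).matMDiffAt hS hy
    have hX : MatMDiffAt (fun y => mat (Φ y l * F y 1)) y :=
      ((hΦ.smooth l).matMDiffAt isOpen_univ (Set.mem_univ y)).mul ((hF.smooth 1).matMDiffAt hS hy)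
    refine ⟨hX.mul (hFl.mat_inv hdet), fun v => ?_⟩
    rw [rdiff_mul hX (hFl.mat_inv hdet), rdiff_mat_inv hdet hFl,
      rdiff_solution_mul_frame hdet hσ hF hΦ hy, hF.ode y hy, mul_neg, ← mul_assoc (mat (F y l)⁻¹),
      mat_inv_mul_mat, one_mul, mul_assoc, add_neg_cancel]
  have h1 := eq_of_locallyConstant_off_finite hF.finite
    (f := fun y => mat (Φ y l * F y 1) * mat (F y l)⁻¹)
    (fun y hy => eventually_eq_of_rdiff_eq_zero
      (by filter_upwards [hS.mem_nhds hy] with w hw using hzero w hw)) hz hF.base_notMem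
  simp only [← mat_mul] at h1
  have h2 := mat_injective h1
  rw [hF.base, hF.base, inv_one, mul_one, mul_one] at h2
  exact mul_inv_eq_iff_eq_mul.1 h2

lemma IsExtendedSolution.continuous_apply {r : WithTop ℕ∞} {φ : X → G} {Φ : X → Circle → G}
    (hΦ : IsExtendedSolution r φ Φ) (l : Circle) (i j : Fin n) :
    Continuous fun z => mat (Φ z l) i j :=
  continuousOn_univ.1 (hΦ.smooth l i j).continuousOn

lemma exists_isLaurentOn_of_isAlgebraic (hdet : ∀ g : G, (mat g).det = 1)
    (hσ : ∀ g : G, symm h (symm h g) = g) [T2Space X] [PreconnectedSpace X]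
    [IsManifold 𝓘(ℂ) ω X] {r : WithTop ℕ∞} {𝓕 : X → G ⧸ fixSub h} {z₀ : X}
    {Φ : X → Circle → G} (hΦ : IsExtendedSolution r (cartan h ∘ 𝓕) Φ)
    (halg : IsAlgebraic r h 𝓕 z₀) :
    ∃ B ∈ basedLoops r G, IsLaurentOn Set.univ (fun z l => B l * Φ z l) := by
  obtain ⟨S, F, hF, hL⟩ := halg
  refine ⟨fun l => (Φ z₀ l)⁻¹, inv_mem_basedLoops hdet (hΦ.based z₀), isLaurentOn_iff.2 fun i j => ?_⟩
  -- The frame gives information only off `S`, whereas `Φ` is continuous across `S`.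
  refine mem_laurentSubring_univ_of_dense (dense_compl_of_finite hF.finite) (fun l => ?_) ?_
  · simp only [mat_mul, Matrix.mul_apply]
    exact continuous_finsetSum _ fun k _ => continuous_const.mul (hΦ.continuous_apply l k j)
  · refine mem_laurentSubring_congr (mul_apply_mem _ (isLaurentOn_iff.1 hL)
      (fun i j => mem_laurentSubring_of_const Sᶜ fun z => mat (F z 1)⁻¹ i j) i j) fun z hz l => ?_
    simp only [← mat_mul]
    rw [eq_mul_inv_of_mul_eq (solution_mul_frame_eq hdet hσ hF hΦ hz l), mul_assoc,
      inv_mul_cancel_left]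

/-- In `F(z,λ) = (BΦ(z₀,λ))⁻¹ (BΦ(z,λ)) F(z,1)` the factor `B` cancels. The first two factors are
Laurent, the inverse because it is an adjugate, and the last does not involve `λ`. -/
lemma IsExtendedFrame.isLaurentOn (hdet : ∀ g : G, (mat g).det = 1)
    (hσ : ∀ g : G, symm h (symm h g) = g) [T2Space X] [PreconnectedSpace X]
    [IsManifold 𝓘(ℂ) ω X] {r : WithTop ℕ∞} {𝓕 : X → G ⧸ fixSub h} {z₀ : X} {S : Set X}
    {F Φ : X → Circle → G} (hF : IsExtendedFrame r h 𝓕 z₀ S F)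
    (hΦ : IsExtendedSolution r (cartan h ∘ 𝓕) Φ) {B : Circle → G}
    (hB : IsLaurentOn Set.univ (fun z l => B l * Φ z l)) : IsLaurentOn Sᶜ F := by
  have h1 := isLaurentOn_iff.1 hB
  have h2 : ∀ i j, (fun p : X × Circle => mat (B p.2 * Φ z₀ p.2)⁻¹ i j) ∈ laurentSubring Sᶜ :=
    mat_inv_apply_mem _ (fun _ => hdet _) fun i j =>
      mem_laurentSubring_comp (h1 i j) (fun _ => z₀) fun _ _ => Set.mem_univ _
  have h3 : ∀ i j, (fun p : X × Circle => mat (B p.2 * Φ p.1 p.2) i j) ∈ laurentSubring Sᶜ :=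
    fun i j => mem_laurentSubring_comp (h1 i j) id fun _ _ => Set.mem_univ _
  refine isLaurentOn_iff.2 fun i j => mem_laurentSubring_congr
    (mul_apply_mem _ h2 (mul_apply_mem _ h3
      (fun i j => mem_laurentSubring_of_const Sᶜ fun z => mat (F z 1) i j)) i j) fun z hz l => ?_
  simp only [← mat_mul]
  rw [mul_assoc (B l), solution_mul_frame_eq hdet hσ hF hΦ hz l, ← mul_assoc (B l),
    inv_mul_cancel_left]

end Frames

end AlgHarm

theorem mainTheorem10 {n : ℕ} (𝔤 : LieSubalgebra ℝ (Matrix (Fin n) (Fin n) ℂ))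
    (h𝔤 : LieAlgebra.IsSemisimple ℝ 𝔤)
    (h : AlgHarm.matrixGroup 𝔤)
    (hσ : ∀ g : AlgHarm.matrixGroup 𝔤, AlgHarm.symm h (AlgHarm.symm h g) = g)
    {M : Type*} [TopologicalSpace M] [T2Space M] [ConnectedSpace M] [ChartedSpace ℂ M]
    [IsManifold 𝓘(ℂ) ω M]
    {M' : Type*} [TopologicalSpace M'] [T2Space M'] [SimplyConnectedSpace M'] [ChartedSpace ℂ M']
    [IsManifold 𝓘(ℂ) ω M']
    (π : M' → M) (hπ : IsCoveringMap π) (hπ' : ContMDiff 𝓘(ℂ) 𝓘(ℂ) ω π) (z₀ : M')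
    (r : WithTop ℕ∞)
    (𝓕 : M → AlgHarm.matrixGroup 𝔤 ⧸ AlgHarm.fixSub h) (h𝓕 : AlgHarm.IsHarmonic h 𝓕)
    (S : Set M') (F : M' → Circle → AlgHarm.matrixGroup 𝔤)
    (hF : AlgHarm.IsExtendedFrame r h (𝓕 ∘ π) z₀ S F)
    (Φ : M' → Circle → AlgHarm.matrixGroup 𝔤)
    (hΦ : AlgHarm.IsExtendedSolution r (AlgHarm.cartan h ∘ 𝓕 ∘ π) Φ) :
    AlgHarm.IsAlgebraic r h (𝓕 ∘ π) z₀ ↔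
      ∃ B ∈ AlgHarm.basedLoops r (AlgHarm.matrixGroup 𝔤),
        AlgHarm.IsLaurentOn Set.univ (fun z l => B l * Φ z l) := by
  have hdet := AlgHarm.det_mat_eq_one h𝔤
  exact ⟨AlgHarm.exists_isLaurentOn_of_isAlgebraic hdet hσ hΦ,
    fun ⟨_, _, hB⟩ => ⟨S, F, hF, hF.isLaurentOn hdet hσ hΦ hB⟩⟩
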